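/- Let $\beta>1$ be a real number and let $T_\beta(x)=\beta x-\lfloor\beta x\rfloor$ be the $\beta$-transformation of $[0,1]$. For $x\in[0,1)$ consider $\liminf_{n\to\infty}\frac{\log T_\beta^n x}{\log n}\in[-\infty,+\infty]$, with the convention $\log 0=-\infty$. Then for every real $\alpha\ge 0$, $$\dim_{\rm H}\left\{x\in[0,1):\ \liminf_{n\to\infty}\frac{\log T_\beta^n x}{\log n}=-\alpha\right\}=1,$$ where $\dim_{\rm H}$ denotes Hausdorff dimension. Consequently, the set $$\left\{x\in[0,1):\ \liminf_{n\to\infty}\frac{\log T_\beta^n x}{\log n}\ne-1\right\}$$ also has Hausdorff dimension $1$. -/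

import Mathlib

open Filter Set

/-- The `β`-transformation `T_β x = β x - ⌊β x⌋`; it maps `[0,1]` into `[0,1) ⊆ [0,1]`. -/
noncomputable def betaT (β x : ℝ) : ℝ := β * x - (⌊β * x⌋ : ℝ)

/-- The extended real number `liminf_{n → ∞} log (T_β^n x) / log n`, where `log 0 = -∞`.
(The finitely many terms with `log n = 0` do not matter.) -/
noncomputable def orbitExponent (β x : ℝ) : EReal :=
  liminf (fun n : ℕ =>
    ENNReal.log (ENNReal.ofReal ((betaT β)^[n] x)) / ((Real.log (n : ℝ) : ℝ) : EReal)) atTop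

/-! The upper bound is trivial, since the sets lie in the line. For the lower bound, a large set of
points is built by concatenation: the `k`-th block is a full cylinder of a fixed order `N`, chosen
freely from `M` candidates, followed by `ℓ k` zeros. Full cylinders concatenate without restriction,
so every sequence of choices is admissible.

The lengths `ℓ k` vanish unless `k + 1` is a power of `2`, where `β ^ ℓ k` is about `(k + 1) ^ α`
(`exists_sparse_lengths`). The zeros bring the orbit down to order `n ^ (-α)` infinitely often, and
it never goes below that order (`orbitExponent_blockTail`).

Only `O(log² k)` zeros occur before block `k`, so they cost no dimension. Counting full cylinders
(`card_fullLeft`) gives `M ≥ β ^ (N s)` for any prescribed `s < 1`. Reading the choices as base-`M`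
digits then maps the set onto `[0,1]` by a Hölder map of exponent `r` for any `r < 1`
(`le_dimH_range_blockTail`), which forces dimension at least `r`. -/

theorem betaT_nonneg (β x : ℝ) : 0 ≤ betaT β x := by
  unfold betaT; linarith [Int.floor_le (β * x)]

theorem betaT_lt_one (β x : ℝ) : betaT β x < 1 := by
  unfold betaT; linarith [Int.lt_floor_add_one (β * x)]

theorem betaT_iterate_nonneg {β x : ℝ} (hx : 0 ≤ x) (n : ℕ) : 0 ≤ (betaT β)^[n] x := by
  cases n with
  | zero => exact hx
  | succ n => rw [Function.iterate_succ_apply']; exact betaT_nonneg _ _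

theorem betaT_iterate_lt_one {β x : ℝ} (hx : x < 1) (n : ℕ) : (betaT β)^[n] x < 1 := by
  cases n with
  | zero => exact hx
  | succ n => rw [Function.iterate_succ_apply']; exact betaT_lt_one _ _

theorem betaT_le_mul {β x : ℝ} (hβ : 1 < β) (hx : 0 ≤ x) : betaT β x ≤ β * x := by
  have : (0 : ℝ) ≤ (⌊β * x⌋ : ℝ) := by
    exact_mod_cast Int.floor_nonneg.mpr (by positivity)
  unfold betaT; linarith

theorem betaT_iterate_le {β x : ℝ} (hβ : 1 < β) (hx : 0 ≤ x) (n : ℕ) :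
    (betaT β)^[n] x ≤ β ^ n * x := by
  induction n with
  | zero => simp
  | succ n ih =>
    rw [Function.iterate_succ_apply']
    calc _ ≤ β * (betaT β)^[n] x := betaT_le_mul hβ (betaT_iterate_nonneg hx n)
      _ ≤ β * (β ^ n * x) := by gcongr
      _ = _ := by ring

/-- `T_β` is affine on the fibres of `x ↦ ⌊β x⌋`. -/
theorem betaT_add {β x h : ℝ} (h₀ : -betaT β x ≤ β * h) (h₁ : β * h < 1 - betaT β x) :
    betaT β (x + h) = betaT β x + β * h := by
  have : ⌊β * (x + h)⌋ = ⌊β * x⌋ := by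
    rw [Int.floor_eq_iff]
    unfold betaT at h₀ h₁
    constructor <;> linarith
  unfold betaT
  rw [this]; ring

/-- To the left of a point, an iterate of `T_β` is affine as long as it stays nonnegative. -/
theorem betaT_iterate_sub {β x : ℝ} (hβ : 1 < β) (hx : 0 ≤ x) (n : ℕ) {h : ℝ} (h₀ : 0 ≤ h)
    (hh : β ^ n * h ≤ (betaT β)^[n] x) :
    (betaT β)^[n] (x - h) = (betaT β)^[n] x - β ^ n * h := by
  induction n with
  | zero => simp
  | succ n ih =>
    rw [Function.iterate_succ_apply'] at hh
    have h1 := betaT_le_mul hβ (betaT_iterate_nonneg (β := β) hx n)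
    have h2 : β ^ n * h ≤ (betaT β)^[n] x := by
      have : β * (β ^ n * h) ≤ β * (betaT β)^[n] x := by
        calc _ = β ^ (n + 1) * h := by ring
          _ ≤ _ := hh.trans h1
      exact le_of_mul_le_mul_left this (by linarith)
    rw [Function.iterate_succ_apply', Function.iterate_succ_apply', ih h2, sub_eq_add_neg,
      betaT_add]
    · ring
    · rw [pow_succ'] at hh; nlinarith
    · have : 0 ≤ β * (β ^ n * h) := by positivity
      linarith [betaT_lt_one β ((betaT β)^[n] x)]

/-! ### Full cylinders: concatenation, separation and counting -/

/-- Left end points of the full cylinders of order `n` of `T_β`. -/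
def fullLeft (β : ℝ) (n : ℕ) : Set ℝ :=
  {a | 0 ≤ a ∧ a + 1 / β ^ n ≤ 1 ∧
    ∀ u ∈ Ico (0 : ℝ) 1, (betaT β)^[n] (a + u / β ^ n) = u}

theorem fullLeft_comp {β : ℝ} (hβ : 1 < β) {m n : ℕ} {a b : ℝ} (ha : a ∈ fullLeft β m)
    (hb : b ∈ fullLeft β n) : a + b / β ^ m ∈ fullLeft β (m + n) := by
  obtain ⟨a0, a1, ha⟩ := ha
  obtain ⟨b0, b1, hb⟩ := hb
  have hm : 0 < β ^ m := by positivity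
  have hn : 0 < β ^ n := by positivity
  refine ⟨by positivity, ?_, fun u hu => ?_⟩
  · calc a + b / β ^ m + 1 / β ^ (m + n) = a + (b + 1 / β ^ n) / β ^ m := by
          rw [pow_add]; field_simp; ring
      _ ≤ a + 1 / β ^ m := by gcongr
      _ ≤ 1 := a1
  · have e : a + b / β ^ m + u / β ^ (m + n) = a + (b + u / β ^ n) / β ^ m := by
      rw [pow_add]; field_simp; ring
    have h1 : u / β ^ n < 1 / β ^ n := by have := hu.2; gcongr
    have h2 : 0 ≤ u / β ^ n := div_nonneg hu.1 hn.le
    rw [e, add_comm m n, Function.iterate_add_apply, ha _ ⟨by linarith, by linarith⟩, hb u hu]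

theorem zero_mem_fullLeft {β : ℝ} (hβ : 1 < β) (n : ℕ) : (0 : ℝ) ∈ fullLeft β n := by
  have hn : 1 ≤ β ^ n := one_le_pow₀ hβ.le
  induction n with
  | zero => exact ⟨le_rfl, by simp, fun u _ => by simp⟩
  | succ n ih =>
    have h1 : (0 : ℝ) ∈ fullLeft β 1 := by
      refine ⟨le_rfl, ?_, fun u hu => ?_⟩
      · rw [pow_one, zero_add, div_le_one (by linarith)]; exact hβ.le
      · have : β * (u / β) = u := by field_simp
        simp [betaT, this, Int.floor_eq_zero_iff.mpr hu]
    simpa using fullLeft_comp hβ (ih (one_le_pow₀ hβ.le)) h1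

theorem fullLeft_mono {β : ℝ} (hβ : 1 < β) {m n : ℕ} (h : m ≤ n) :
    fullLeft β m ⊆ fullLeft β n := by
  intro a ha
  obtain ⟨k, rfl⟩ := Nat.exists_eq_add_of_le h
  simpa using fullLeft_comp hβ ha (zero_mem_fullLeft hβ k)

theorem fullLeft_separated {β : ℝ} (hβ : 1 < β) {n : ℕ} {a b : ℝ} (ha : a ∈ fullLeft β n)
    (hb : b ∈ fullLeft β n) (hab : a < b) : a + 1 / β ^ n ≤ b := by
  by_contra! h
  have hn : 0 < β ^ n := by positivity
  have e : a + (b - a) * β ^ n / β ^ n = b := by field_simp; ring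
  have hpos : 0 < (b - a) * β ^ n := mul_pos (by linarith) hn
  have h1 : (b - a) * β ^ n < 1 := by
    rw [← lt_div_iff₀ hn]; linarith
  have h2 := ha.2.2 ((b - a) * β ^ n) ⟨hpos.le, h1⟩
  have h3 := hb.2.2 0 (by simp)
  rw [e] at h2
  rw [zero_div, add_zero] at h3
  linarith

theorem fullLeft_finite {β : ℝ} (hβ : 1 < β) (n : ℕ) : (fullLeft β n).Finite := by
  have hn : 0 < β ^ n := by positivity
  have key : ∀ a ∈ fullLeft β n, ∀ b ∈ fullLeft β n, a < b → ⌊a * β ^ n⌋ < ⌊b * β ^ n⌋ := by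
    intro a ha b hb hab
    have h1 := fullLeft_separated hβ ha hb hab
    have h2 : a * β ^ n + 1 ≤ b * β ^ n := by
      calc _ = (a + 1 / β ^ n) * β ^ n := by field_simp
        _ ≤ _ := by gcongr
    have : ⌊a * β ^ n⌋ + 1 ≤ ⌊b * β ^ n⌋ := by
      rw [← Int.floor_add_one]; exact Int.floor_le_floor h2
    omega
  refine Set.Finite.of_finite_image (f := fun a => ⌊a * β ^ n⌋) ?_ ?_
  · refine (Set.finite_Icc 0 ⌊β ^ n⌋).subset ?_
    rintro _ ⟨a, ha, rfl⟩
    refine ⟨Int.floor_nonneg.mpr (mul_nonneg ha.1 hn.le), Int.floor_le_floor ?_⟩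
    have : a ≤ 1 := by have := ha.2.1; have : 0 < 1 / β ^ n := by positivity
                       linarith
    nlinarith
  · intro a ha b hb hab
    rcases lt_trichotomy a b with h | h | h
    · exact absurd hab (key a ha b hb h).ne
    · exact h
    · exact absurd hab (key b hb a ha h).ne'

/-- Every point lies in a full cylinder of order `k ≤ n`, to the right of which `T_β^n` is affine
up to the right end of that cylinder. -/
theorem exists_fullLeft_affine {β x : ℝ} (hβ : 1 < β) (hx : x ∈ Ico (0 : ℝ) 1) (n : ℕ) :
    ∃ k ≤ n, ∃ a ∈ fullLeft β k, a ≤ x ∧ x < a + 1 / β ^ k ∧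
      ∀ h, 0 ≤ h → x + h < a + 1 / β ^ k →
        (betaT β)^[n] (x + h) = (betaT β)^[n] x + β ^ n * h := by
  induction n with
  | zero => exact ⟨0, le_rfl, 0, zero_mem_fullLeft hβ 0, hx.1, by simpa using hx.2, by simp⟩
  | succ n ih =>
    obtain ⟨k, hk, a, ha, hax, hxa, haff⟩ := ih
    have hn : 0 < β ^ n := by positivity
    have hn1 : 0 < β ^ (n + 1) := by positivity
    set y := (betaT β)^[n + 1] x with hy
    have hyT : y = betaT β ((betaT β)^[n] x) := by rw [hy, Function.iterate_succ_apply']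
    have hy0 : 0 ≤ y := betaT_iterate_nonneg hx.1 _
    have hy1 : y < 1 := betaT_iterate_lt_one hx.2 _
    have step : ∀ h, 0 ≤ h → x + h < a + 1 / β ^ k → β ^ (n + 1) * h < 1 - y →
        (betaT β)^[n + 1] (x + h) = y + β ^ (n + 1) * h := by
      intro h h0 h1 h2
      rw [Function.iterate_succ_apply', haff h h0 h1, betaT_add, ← hyT]
      · ring
      · rw [← hyT]
        have : 0 ≤ β * (β ^ n * h) := by positivity
        linarith
      · rw [← hyT]
        calc _ = β ^ (n + 1) * h := by ring
          _ < _ := h2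
    -- The branch of `T_β^(n+1)` through `x` would reach the value `1` at `x + (1 - y) / β ^ (n +
    -- 1)`. If the old cylinder ends no later, keep it; otherwise the branch takes all values in
    -- `[0,1)`, and `x` lies in a full cylinder of order `n + 1`.
    by_cases hc : a + 1 / β ^ k ≤ x + (1 - y) / β ^ (n + 1)
    · refine ⟨k, by omega, a, ha, hax, hxa, fun h h0 h1 => step h h0 h1 ?_⟩
      have : h < (1 - y) / β ^ (n + 1) := by linarith
      rwa [lt_div_iff₀' hn1] at this
    · push Not at hc
      have e1 : x - y / β ^ (n + 1) + 1 / β ^ (n + 1) = x + (1 - y) / β ^ (n + 1) := by ring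
      have hyd : 0 ≤ y / β ^ (n + 1) := by positivity
      have hlt : ∀ h, x + h < x - y / β ^ (n + 1) + 1 / β ^ (n + 1) → β ^ (n + 1) * h < 1 - y := by
        intro h h1
        have : h < (1 - y) / β ^ (n + 1) := by linarith
        rwa [lt_div_iff₀' hn1] at this
      refine ⟨n + 1, le_rfl, x - y / β ^ (n + 1), ⟨?_, ?_, fun u hu => ?_⟩, by linarith, ?_,
        fun h h0 h1 => ?_⟩
      · have := betaT_iterate_le hβ hx.1 (n + 1)
        rw [sub_nonneg, div_le_iff₀' hn1]; exact this
      · have := ha.2.1; linarith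
      · have hu' : u / β ^ (n + 1) < 1 / β ^ (n + 1) := by have := hu.2; gcongr
        rcases le_total u y with h | h
        · have e : x - y / β ^ (n + 1) + u / β ^ (n + 1) = x - (y - u) / β ^ (n + 1) := by ring
          have e2 : β ^ (n + 1) * ((y - u) / β ^ (n + 1)) = y - u := by field_simp
          rw [e, betaT_iterate_sub hβ hx.1 _ (div_nonneg (by linarith) hn1.le), e2, ← hy]
          · ring
          · rw [e2, ← hy]; linarith [hu.1]
        · have e : x - y / β ^ (n + 1) + u / β ^ (n + 1) = x + (u - y) / β ^ (n + 1) := by ring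
          have e2 : β ^ (n + 1) * ((u - y) / β ^ (n + 1)) = u - y := by field_simp
          have : x + (u - y) / β ^ (n + 1) < a + 1 / β ^ k := by rw [← e]; linarith
          rw [e, step _ (div_nonneg (by linarith) hn1.le) this (by rw [e2]; linarith [hu.2]), e2]
          ring
      · rw [e1]
        have : 0 < (1 - y) / β ^ (n + 1) := div_pos (by linarith) hn1
        linarith
      · exact step h h0 (by linarith) (hlt h h1)

/-- If the right end were more than `1 / β ^ n` away, moving right by `1 / β ^ n` would raise
`T_β^n` by `1`, out of `[0,1)`. -/
theorem exists_fullLeft_near_right {β x : ℝ} (hβ : 1 < β) (hx : x ∈ Ico (0 : ℝ) 1) (n : ℕ) :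
    ∃ k ≤ n, ∃ a ∈ fullLeft β k, x ∈ Ico (a + 1 / β ^ k - 1 / β ^ n) (a + 1 / β ^ k) := by
  obtain ⟨k, hk, a, ha, -, hxa, haff⟩ := exists_fullLeft_affine hβ hx n
  refine ⟨k, hk, a, ha, ?_, hxa⟩
  by_contra! h
  have hn : 0 < β ^ n := by positivity
  have h1 := haff (1 / β ^ n) (by positivity) (by linarith)
  have e : β ^ n * (1 / β ^ n) = 1 := by field_simp
  rw [e] at h1
  have h2 : x + 1 / β ^ n < 1 := by linarith [ha.2.1]
  linarith [betaT_iterate_lt_one (β := β) h2 n, betaT_iterate_nonneg (β := β) hx.1 n]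

/-- The intervals of length `1 / β ^ n` from `exists_fullLeft_near_right` cover `[0,1)`. There are
`n + 1` orders `k`, each contributing at most as many intervals as order `n`, by `fullLeft_mono`;
compare lengths. -/
theorem card_fullLeft {β : ℝ} (hβ : 1 < β) (n : ℕ) :
    β ^ n ≤ (n + 1) * (fullLeft β n).ncard := by
  have hn : 0 < β ^ n := by positivity
  let F : ℕ → Finset ℝ := fun k => (fullLeft_finite hβ k).toFinset
  have hsub : Ico (0 : ℝ) 1 ⊆ ⋃ k ∈ Finset.range (n + 1), ⋃ a ∈ F k,
      Ico (a + 1 / β ^ k - 1 / β ^ n) (a + 1 / β ^ k) := by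
    intro x hx
    obtain ⟨k, hk, a, ha, h⟩ := exists_fullLeft_near_right hβ hx n
    simp only [mem_iUnion]
    exact ⟨k, Finset.mem_range.mpr (by omega), a, by simpa [F] using ha, h⟩
  have hcard : ∀ k ∈ Finset.range (n + 1), (F k).card ≤ (fullLeft β n).ncard := by
    intro k hk
    rw [← Set.ncard_eq_toFinset_card _ (fullLeft_finite hβ k)]
    exact Set.ncard_le_ncard (fullLeft_mono hβ (by simpa [Nat.lt_succ_iff] using hk))
      (fullLeft_finite hβ n)
  have h1 : (1 : ENNReal) ≤ ((n + 1 : ℕ) * (fullLeft β n).ncard : ℕ) * ENNReal.ofReal (1 / β ^ n) := by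
    calc (1 : ENNReal) = MeasureTheory.volume (Ico (0 : ℝ) 1) := by simp
      _ ≤ _ := MeasureTheory.measure_mono hsub
      _ ≤ ∑ k ∈ Finset.range (n + 1), ∑ a ∈ F k, MeasureTheory.volume
            (Ico (a + 1 / β ^ k - 1 / β ^ n) (a + 1 / β ^ k)) :=
          (MeasureTheory.measure_biUnion_finset_le _ _).trans
            (Finset.sum_le_sum fun k _ => MeasureTheory.measure_biUnion_finset_le _ _)
      _ = ∑ k ∈ Finset.range (n + 1), ((F k).card : ENNReal) * ENNReal.ofReal (1 / β ^ n) := by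
          simp [Real.volume_Ico]
      _ ≤ ∑ k ∈ Finset.range (n + 1), ((fullLeft β n).ncard : ENNReal) * ENNReal.ofReal (1 / β ^ n) := by
          refine Finset.sum_le_sum fun k hk => ?_
          gcongr
          exact hcard k hk
      _ = _ := by simp [mul_assoc]
  rw [← ENNReal.ofReal_natCast, ← ENNReal.ofReal_mul (by positivity), ENNReal.one_le_ofReal] at h1
  rw [mul_one_div, le_div_iff₀ hn] at h1
  push_cast at h1
  linarith

/-! ### Points built from blocks and zeros -/

/-- Left end points of full cylinders of order `N` that stay `c` away from both ends of `[0,1]`. -/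
def blockAlphabet (β : ℝ) (N : ℕ) (c : ℝ) : Set ℝ :=
  {a | a ∈ fullLeft β N ∧ c ≤ a ∧ a + 1 / β ^ N ≤ 1 - c}

/-- The starting time of the `k`-th block when the `i`-th block has length `N + ℓ i`. -/
def blockTime (N : ℕ) (ℓ : ℕ → ℕ) (k : ℕ) : ℕ := ∑ i ∈ Finset.range k, (N + ℓ i)

/-- The point whose expansion is the concatenation, from the `k`-th on, of the blocks consisting of
the cylinder `a i` of order `N` followed by `ℓ i` zeros. -/
noncomputable def blockTail (β : ℝ) (N : ℕ) (ℓ : ℕ → ℕ) (a : ℕ → ℝ) (k : ℕ) : ℝ :=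
  β ^ blockTime N ℓ k * ∑' i, a (i + k) / β ^ blockTime N ℓ (i + k)

theorem blockTime_succ (N : ℕ) (ℓ : ℕ → ℕ) (k : ℕ) :
    blockTime N ℓ (k + 1) = blockTime N ℓ k + (N + ℓ k) := Finset.sum_range_succ _ _

theorem le_blockTime {N : ℕ} (hN : 1 ≤ N) (ℓ : ℕ → ℕ) (k : ℕ) : k ≤ blockTime N ℓ k := by
  induction k with
  | zero => simp
  | succ k ih => rw [blockTime_succ]; omega

theorem blockTime_eq (N : ℕ) (ℓ : ℕ → ℕ) (k : ℕ) :
    blockTime N ℓ k = N * k + ∑ i ∈ Finset.range k, ℓ i := by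
  simp [blockTime, Finset.sum_add_distrib, mul_comm]

section Tail

variable {β : ℝ} {N : ℕ} {c : ℝ} {ℓ : ℕ → ℕ} {a : ℕ → ℝ}

/-- Since `a i ≤ 1 - 1 / β ^ N ≤ 1 - 1 / β ^ (N + ℓ i)`, the sum is dominated by a telescoping one.
-/
theorem block_sum_le (hβ : 1 < β) (hc : 0 < c) (ha : ∀ k, a k ∈ blockAlphabet β N c) (k n : ℕ) :
    ∑ i ∈ Finset.range n, a (i + k) / β ^ blockTime N ℓ (i + k) ≤ 1 / β ^ blockTime N ℓ k := by
  have key : ∀ i, a i / β ^ blockTime N ℓ i ≤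
      1 / β ^ blockTime N ℓ i - 1 / β ^ blockTime N ℓ (i + 1) := by
    intro i
    have h1 := (ha i).2.2
    have h2 : 1 / β ^ (N + ℓ i) ≤ 1 / β ^ N :=
      one_div_le_one_div_of_le (by positivity) (pow_le_pow_right₀ hβ.le (by omega))
    have h3 : 1 / β ^ blockTime N ℓ i - 1 / β ^ blockTime N ℓ (i + 1) =
        (1 - 1 / β ^ (N + ℓ i)) / β ^ blockTime N ℓ i := by
      rw [blockTime_succ, pow_add β (blockTime N ℓ i)]; field_simp
    rw [h3]
    gcongr
    linarith
  calc _ ≤ ∑ i ∈ Finset.range n, (1 / β ^ blockTime N ℓ (i + k) -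
        1 / β ^ blockTime N ℓ (i + 1 + k)) :=
        Finset.sum_le_sum fun i _ => by
          have := key (i + k)
          rwa [show i + k + 1 = i + 1 + k by ring] at this
    _ = 1 / β ^ blockTime N ℓ (0 + k) - 1 / β ^ blockTime N ℓ (n + k) :=
        Finset.sum_range_sub' (fun i => 1 / β ^ blockTime N ℓ (i + k)) n
    _ ≤ _ := by
        have : 0 < 1 / β ^ blockTime N ℓ (n + k) := by positivity
        rw [zero_add]; linarith

theorem block_term_nonneg (hβ : 1 < β) (ha : ∀ k, a k ∈ blockAlphabet β N c) (i : ℕ) :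
    0 ≤ a i / β ^ blockTime N ℓ i :=
  div_nonneg (ha i).1.1 (by positivity)

theorem blockTail_nonneg (hβ : 1 < β) (ha : ∀ k, a k ∈ blockAlphabet β N c) (k : ℕ) :
    0 ≤ blockTail β N ℓ a k :=
  mul_nonneg (by positivity) (tsum_nonneg fun i => block_term_nonneg hβ ha (i + k))

theorem blockTail_le_one (hβ : 1 < β) (hc : 0 < c) (ha : ∀ k, a k ∈ blockAlphabet β N c) (k : ℕ) :
    blockTail β N ℓ a k ≤ 1 := by
  have h := Real.tsum_le_of_sum_range_le (fun i => block_term_nonneg hβ ha (i + k))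
    (block_sum_le (ℓ := ℓ) hβ hc ha k)
  rwa [le_div_iff₀' (by positivity)] at h

theorem blockTail_eq (hβ : 1 < β) (hc : 0 < c) (ha : ∀ k, a k ∈ blockAlphabet β N c) (k : ℕ) :
    blockTail β N ℓ a k = a k + blockTail β N ℓ a (k + 1) / β ^ (N + ℓ k) := by
  have hs : Summable fun i => a (i + k) / β ^ blockTime N ℓ (i + k) :=
    summable_of_sum_range_le (fun i => block_term_nonneg hβ ha (i + k)) (block_sum_le hβ hc ha k)
  unfold blockTail
  rw [hs.tsum_eq_zero_add, blockTime_succ, pow_add]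
  simp only [zero_add, add_right_comm _ 1 k, ← add_assoc]
  field_simp

theorem le_blockTail (hβ : 1 < β) (hc : 0 < c) (ha : ∀ k, a k ∈ blockAlphabet β N c) (k : ℕ) :
    c ≤ blockTail β N ℓ a k := by
  rw [blockTail_eq hβ hc ha]
  have := blockTail_nonneg (ℓ := ℓ) hβ ha (k + 1)
  have : 0 ≤ blockTail β N ℓ a (k + 1) / β ^ (N + ℓ k) := by positivity
  linarith [(ha k).2.1]

theorem blockTail_div_le (hβ : 1 < β) (ha : ∀ k, a k ∈ blockAlphabet β N c)
    (k m : ℕ) : blockTail β N ℓ a k / β ^ (N + m) ≤ blockTail β N ℓ a k / β ^ N := by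
  have := blockTail_nonneg (ℓ := ℓ) hβ ha k
  gcongr
  · exact hβ.le
  · omega

theorem blockTail_le (hβ : 1 < β) (hc : 0 < c) (ha : ∀ k, a k ∈ blockAlphabet β N c) (k : ℕ) :
    blockTail β N ℓ a k ≤ 1 - c := by
  rw [blockTail_eq hβ hc ha]
  have h1 := blockTail_div_le (ℓ := ℓ) hβ ha (k + 1) (ℓ k)
  have h2 : blockTail β N ℓ a (k + 1) / β ^ N ≤ 1 / β ^ N := by
    have := blockTail_le_one (ℓ := ℓ) hβ hc ha (k + 1); gcongr
  linarith [(ha k).2.2]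

theorem blockTail_mem_Ico (hβ : 1 < β) (hc : 0 < c) (ha : ∀ k, a k ∈ blockAlphabet β N c) (k : ℕ) :
    blockTail β N ℓ a k ∈ Ico (0 : ℝ) 1 :=
  ⟨blockTail_nonneg hβ ha k, by linarith [blockTail_le (ℓ := ℓ) hβ hc ha k]⟩

theorem iterate_blockTail (hβ : 1 < β) (hc : 0 < c) (ha : ∀ k, a k ∈ blockAlphabet β N c) (k : ℕ) :
    (betaT β)^[N + ℓ k] (blockTail β N ℓ a k) = blockTail β N ℓ a (k + 1) := by
  rw [blockTail_eq hβ hc ha k]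
  exact (fullLeft_mono hβ (Nat.le_add_right N (ℓ k)) (ha k).1).2.2 _ (blockTail_mem_Ico hβ hc ha _)

theorem iterate_blockTime (hβ : 1 < β) (hc : 0 < c) (ha : ∀ k, a k ∈ blockAlphabet β N c) (k : ℕ) :
    (betaT β)^[blockTime N ℓ k] (blockTail β N ℓ a 0) = blockTail β N ℓ a k := by
  induction k with
  | zero => simp [blockTime]
  | succ k ih =>
    rw [blockTime_succ, add_comm, Function.iterate_add_apply, ih, iterate_blockTail hβ hc ha]

/-- At this time the cylinder has been read and the `ℓ k` zeros begin: these are the close returns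
to `0`. -/
theorem iterate_blockTime_add (hβ : 1 < β) (hc : 0 < c) (ha : ∀ k, a k ∈ blockAlphabet β N c)
    (k : ℕ) : (betaT β)^[blockTime N ℓ k + N] (blockTail β N ℓ a 0) ≤ 1 / β ^ ℓ k := by
  have h := blockTail_mem_Ico (ℓ := ℓ) hβ hc ha (k + 1)
  have hp : 1 ≤ β ^ ℓ k := one_le_pow₀ hβ.le
  have e : blockTail β N ℓ a k = a k + blockTail β N ℓ a (k + 1) / β ^ ℓ k / β ^ N := by
    rw [blockTail_eq hβ hc ha k, add_comm N, pow_add, div_div]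
  have h1 : blockTail β N ℓ a (k + 1) / β ^ ℓ k ≤ blockTail β N ℓ a (k + 1) :=
    div_le_self h.1 hp
  rw [add_comm, Function.iterate_add_apply, iterate_blockTime hβ hc ha, e,
    (ha k).1.2.2 _ ⟨div_nonneg h.1 (by positivity), h1.trans_lt h.2⟩]
  have := h.2.le
  gcongr

/-- Take the block containing `t`. It ends within `N + ℓ k` steps at a point that is at least `c`,
and each step multiplies by at most `β`. -/
theorem exists_le_iterate_blockTail (hβ : 1 < β) (hN : 1 ≤ N) (hc : 0 < c)
    (ha : ∀ k, a k ∈ blockAlphabet β N c) (t : ℕ) :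
    ∃ k ≤ t, c / (β ^ N * β ^ ℓ k) ≤ (betaT β)^[t] (blockTail β N ℓ a 0) := by
  have hex : ∃ k, t < blockTime N ℓ (k + 1) := ⟨t, le_blockTime hN ℓ (t + 1)⟩
  classical
  set k := Nat.find hex with hk
  have h1 : t < blockTime N ℓ (k + 1) := Nat.find_spec hex
  have h2 : blockTime N ℓ k ≤ t := by
    rcases Nat.eq_zero_or_pos k with h | h
    · simp [h, blockTime]
    · have := Nat.find_min hex (m := k - 1) (by omega)
      rwa [Nat.sub_add_cancel h, not_lt] at this
  refine ⟨k, (le_blockTime hN ℓ k).trans h2, ?_⟩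
  obtain ⟨r, hr⟩ := Nat.exists_eq_add_of_le h1.le
  have hrle : r ≤ N + ℓ k := by rw [blockTime_succ] at hr; omega
  have h0 := betaT_iterate_nonneg (β := β) (blockTail_nonneg (ℓ := ℓ) hβ ha 0) t
  have h3 := betaT_iterate_le hβ h0 r
  rw [← Function.iterate_add_apply, add_comm r, ← hr, iterate_blockTime hβ hc ha] at h3
  rw [div_le_iff₀' (by positivity), ← pow_add]
  calc c ≤ _ := le_blockTail hβ hc ha (k + 1)
    _ ≤ _ := h3
    _ ≤ _ := by gcongr; exact hβ.le

theorem blockTail_sub (hβ : 1 < β) (hc : 0 < c) (ha : ∀ k, a k ∈ blockAlphabet β N c)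
    {b : ℕ → ℝ} (hb : ∀ k, b k ∈ blockAlphabet β N c) {k : ℕ} (hab : ∀ i < k, a i = b i) :
    blockTail β N ℓ a 0 - blockTail β N ℓ b 0 =
      (blockTail β N ℓ a k - blockTail β N ℓ b k) / β ^ blockTime N ℓ k := by
  induction k with
  | zero => simp [blockTime]
  | succ k ih =>
    rw [ih fun i hi => hab i (by omega), blockTail_eq hβ hc ha k, blockTail_eq hβ hc hb k,
      hab k (by omega), blockTime_succ, pow_add β (blockTime N ℓ k)]
    field_simp
    ring

/-- Left end points are `1 / β ^ N` apart, and the remaining blocks shift the smaller one by at most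
`(1 - c) / β ^ N`. -/
theorem blockTail_separated (hβ : 1 < β) (hc : 0 < c) (ha : ∀ k, a k ∈ blockAlphabet β N c)
    {b : ℕ → ℝ} (hb : ∀ k, b k ∈ blockAlphabet β N c) {k : ℕ} (hab : a k < b k) :
    c / β ^ N ≤ blockTail β N ℓ b k - blockTail β N ℓ a k := by
  have h1 := fullLeft_separated hβ (ha k).1 (hb k).1 hab
  have h2 := blockTail_div_le (ℓ := ℓ) hβ ha (k + 1) (ℓ k)
  have h3 : blockTail β N ℓ a (k + 1) / β ^ N ≤ (1 - c) / β ^ N := by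
    have := blockTail_le (ℓ := ℓ) hβ hc ha (k + 1); gcongr
  have h4 : 0 ≤ blockTail β N ℓ b (k + 1) / β ^ (N + ℓ k) :=
    div_nonneg (blockTail_nonneg hβ hb _) (by positivity)
  rw [blockTail_eq hβ hc ha k, blockTail_eq hβ hc hb k]
  rw [sub_div] at h3
  linarith

theorem le_abs_blockTail_sub (hβ : 1 < β) (hc : 0 < c) (ha : ∀ k, a k ∈ blockAlphabet β N c)
    {b : ℕ → ℝ} (hb : ∀ k, b k ∈ blockAlphabet β N c) {k : ℕ} (hab : ∀ i < k, a i = b i)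
    (hk : a k ≠ b k) :
    c / β ^ N / β ^ blockTime N ℓ k ≤ |blockTail β N ℓ a 0 - blockTail β N ℓ b 0| := by
  rw [blockTail_sub hβ hc ha hb hab, abs_div, abs_of_pos (show 0 < β ^ blockTime N ℓ k by positivity)]
  gcongr
  rcases lt_or_gt_of_ne hk with h | h
  · rw [abs_sub_comm]
    exact (blockTail_separated hβ hc ha hb h).trans (le_abs_self _)
  · exact (blockTail_separated hβ hc hb ha h).trans (le_abs_self _)

end Tail

/-! ### Lower bound for the dimension -/

/-- If two choices first differ at index `k`, their base-`M` numbers are within `M ^ (-k)`, while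
the points are at least `c / β ^ N / β ^ blockTime N ℓ k` apart. By `hC` the map from points to
numbers is `r`-Hölder, and it is onto `[0,1]`. -/
theorem le_dimH_range_blockTail {β : ℝ} (hβ : 1 < β) {N : ℕ} {c : ℝ} (hc : 0 < c) {ℓ : ℕ → ℕ}
    {M : ℕ} (hM : 1 < M) {e : Fin M → ℝ} (he : Function.Injective e)
    (heA : ∀ j, e j ∈ blockAlphabet β N c) {r : NNReal} (hr : 0 < r) {C : ℝ}
    (hC : ∀ k, (β ^ blockTime N ℓ k) ^ (r : ℝ) ≤ C * (M : ℝ) ^ k) :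
    (r : ENNReal) ≤ dimH (range fun d : ℕ → Fin M => blockTail β N ℓ (fun i => e (d i)) 0) := by
  set X : (ℕ → Fin M) → ℝ := fun d => blockTail β N ℓ (fun i => e (d i)) 0 with hX
  have hC0 : 0 < C := by
    have := hC 0
    simp [blockTime] at this
    linarith
  have key : ∀ d d', |Real.ofDigits d - Real.ofDigits d'| ≤
      (C * (β ^ N / c) ^ (r : ℝ)) * |X d - X d'| ^ (r : ℝ) := by
    intro d d'
    by_cases hdd : d = d'
    · subst hdd
      simp [hr.ne']
    have hex : ∃ k, d k ≠ d' k := Function.ne_iff.mp hdd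
    classical
    have h1 : ∀ i < Nat.find hex, d i = d' i := fun i hi => not_not.mp (Nat.find_min hex hi)
    have h2 := Nat.find_spec hex
    set k := Nat.find hex
    have h3 := le_abs_blockTail_sub (ℓ := ℓ) (a := fun i => e (d i)) (b := fun i => e (d' i)) (k := k)
      hβ hc (fun i => heA _) (fun i => heA _) (fun i hi => by rw [h1 i hi]) (he.ne h2)
    have hMk : (0 : ℝ) < (M : ℝ) ^ k := by have : 0 < M := by omega
                                           positivity
    have hS : 0 < β ^ blockTime N ℓ k := by positivity
    calc _ ≤ ((M : ℝ) ^ k)⁻¹ := Real.abs_ofDigits_sub_ofDigits_le h1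
      _ ≤ C * ((β ^ blockTime N ℓ k) ^ (r : ℝ))⁻¹ := by
        rw [← div_eq_mul_inv, le_div_iff₀ (by positivity), inv_mul_le_iff₀ hMk, mul_comm]
        exact hC k
      _ = C * ((β ^ blockTime N ℓ k)⁻¹) ^ (r : ℝ) := by rw [Real.inv_rpow hS.le]
      _ ≤ C * ((β ^ N / c) * |X d - X d'|) ^ (r : ℝ) := by
        gcongr
        calc _ = (β ^ N / c) * (c / β ^ N / β ^ blockTime N ℓ k) := by field_simp
          _ ≤ _ := by gcongr
      _ = _ := by rw [Real.mul_rpow (by positivity) (abs_nonneg _)]; ring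
  have : Nonempty (ℕ → Fin M) := ⟨fun _ => ⟨0, by omega⟩⟩
  set K : ℝ := C * (β ^ N / c) ^ (r : ℝ) with hK
  have hK0 : 0 ≤ K := by positivity
  set F : ℝ → ℝ := fun x => Real.ofDigits (Function.invFun X x)
  have hinv : ∀ x ∈ range X, X (Function.invFun X x) = x := fun x hx => Function.invFun_eq hx
  have hF : HolderOnWith K.toNNReal r F (range X) := by
    intro x hx y hy
    have h := key (Function.invFun X x) (Function.invFun X y)
    rw [hinv x hx, hinv y hy] at h
    change _ ≤ ENNReal.ofReal K * _
    rw [edist_dist, edist_dist, ENNReal.ofReal_rpow_of_nonneg dist_nonneg r.coe_nonneg,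
      ← ENNReal.ofReal_mul hK0]
    exact ENNReal.ofReal_le_ofReal h
  have hFX : ∀ d, F (X d) = Real.ofDigits d := by
    intro d
    have h := key (Function.invFun X (X d)) d
    rw [hinv _ ⟨d, rfl⟩, sub_self, abs_zero, Real.zero_rpow (by exact_mod_cast hr.ne'), mul_zero] at h
    exact sub_eq_zero.mp (abs_nonpos_iff.mp h)
  have hsub : Icc (0 : ℝ) 1 ⊆ F '' range X := by
    intro y hy
    obtain ⟨d, -, rfl⟩ := Real.ofDigits_SurjOn hM hy
    exact ⟨X d, ⟨d, rfl⟩, hFX d⟩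
  have h1 : (1 : ENNReal) ≤ dimH (range X) / r := by
    calc (1 : ENNReal) = dimH (Icc (0 : ℝ) 1) := by
          rw [Real.dimH_of_nonempty_interior (by simp)]; simp
      _ ≤ dimH (F '' range X) := dimH_mono hsub
      _ ≤ _ := hF.dimH_image_le hr
  rwa [ENNReal.le_div_iff_mul_le (by simp [hr.ne']) (by simp), one_mul] at h1

/-! ### Choice of the blocks and of the numbers of zeros -/

theorem exists_blocks {β : ℝ} (hβ : 1 < β) {r : ℝ} (hr0 : 0 < r) (hr1 : r < 1) :
    ∃ N : ℕ, 1 ≤ N ∧ ∃ M : ℕ, 1 < M ∧ (β ^ N) ^ r ≤ M ∧ ∃ c : ℝ, 0 < c ∧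
      ∃ e : Fin M → ℝ, Function.Injective e ∧ ∀ j, e j ∈ blockAlphabet β N c := by
  have hβ0 : 0 < β := by linarith
  set q := β ^ r with hq
  have hq1 : 1 < q := Real.one_lt_rpow hβ hr0
  have hqβ : q < β := by
    simpa using Real.rpow_lt_rpow_of_exponent_lt hβ hr1
  have hlim : Tendsto (fun n : ℕ => (n : ℝ) ^ 1 * (q / β) ^ n) atTop (nhds 0) :=
    tendsto_pow_const_mul_const_pow_of_abs_lt_one 1
      (by rw [abs_of_pos (by positivity)]; exact (div_lt_one hβ0).mpr hqβ)
  -- The `1 / 6` comes from `(N + 1) * (q ^ N + 2) ≤ 2 * N * (3 * q ^ N)`.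
  obtain ⟨N, ⟨hN1, hN2⟩, hN⟩ := (((hlim.eventually (gt_mem_nhds (show (0 : ℝ) < 1 / 6 by norm_num))).and
    ((tendsto_pow_atTop_atTop_of_one_lt hq1).eventually_ge_atTop 2)).and (eventually_ge_atTop 1)).exists
  have hβN : 0 < β ^ N := by positivity
  have hNR : (1 : ℝ) ≤ N := by exact_mod_cast hN
  have hbig : (N + 1) * (q ^ N + 2) ≤ β ^ N := by
    rw [pow_one, div_pow, ← mul_div_assoc, div_lt_iff₀ hβN] at hN1
    have h1 : (N + 1 : ℝ) * (q ^ N + 2) ≤ (2 * N) * (3 * q ^ N) := by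
      have : (N + 1 : ℝ) ≤ 2 * N := by linarith
      have : q ^ N + 2 ≤ 3 * q ^ N := by nlinarith
      gcongr
    linarith
  have hcard := card_fullLeft hβ N
  -- Only these two positions touch an end of `[0,1]`. The remaining set is finite, so its least
  -- margin is a positive `c`.
  set S : Set ℝ := fullLeft β N \ {0, 1 - 1 / β ^ N} with hS
  have hSf : S.Finite := (fullLeft_finite hβ N).sdiff
  have hSc : (fullLeft β N).ncard ≤ S.ncard + 2 := by
    calc _ ≤ S.ncard + ({0, 1 - 1 / β ^ N} : Set ℝ).ncard :=
          Set.ncard_le_ncard_sdiff_add_ncard _ _ (by simp)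
      _ ≤ _ := by gcongr; exact (Set.ncard_insert_le _ _).trans (by simp)
  have hScR : q ^ N ≤ S.ncard := by
    have h2 : ((fullLeft β N).ncard : ℝ) ≤ S.ncard + 2 := by exact_mod_cast hSc
    have h3 : (N + 1 : ℝ) * (q ^ N + 2) ≤ (N + 1) * (S.ncard + 2) :=
      hbig.trans (hcard.trans (by gcongr))
    linarith [le_of_mul_le_mul_left h3 (by linarith)]
  have hM : 1 < S.ncard := by
    have : (2 : ℝ) ≤ S.ncard := hN2.trans hScR
    exact_mod_cast this
  have hne : S.Nonempty := by
    rw [← Set.ncard_pos hSf]; omega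
  obtain ⟨a, ha, hmin⟩ := hSf.exists_minimalFor (fun a => min a (1 - 1 / β ^ N - a)) S hne
  have hpos : ∀ a ∈ S, 0 < min a (1 - 1 / β ^ N - a) := by
    rintro a ⟨⟨h0, h1, -⟩, h2⟩
    simp only [mem_insert_iff, mem_singleton_iff, not_or] at h2
    exact lt_min (lt_of_le_of_ne h0 (Ne.symm h2.1))
      (sub_pos.mpr (lt_of_le_of_ne (by linarith) h2.2))
  have hmin' : ∀ b ∈ S, min a (1 - 1 / β ^ N - a) ≤ min b (1 - 1 / β ^ N - b) := by
    intro b hb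
    rcases le_total (min a (1 - 1 / β ^ N - a)) (min b (1 - 1 / β ^ N - b)) with h | h
    · exact h
    · exact hmin hb h
  have : Finite S := hSf
  let e : S ≃ Fin S.ncard := Finite.equivFinOfCardEq rfl
  refine ⟨N, hN, S.ncard, hM, ?_, _, hpos a ha, fun j => (e.symm j : ℝ), ?_, fun j => ?_⟩
  · rwa [← Real.rpow_natCast, ← Real.rpow_mul hβ0.le, mul_comm, Real.rpow_mul hβ0.le,
      Real.rpow_natCast]
  · exact Subtype.val_injective.comp e.symm.injective
  · have h := hmin' _ (e.symm j).2
    exact ⟨(e.symm j).2.1, h.trans (min_le_left _ _),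
      by linarith [h.trans (min_le_right _ _)]⟩

theorem exists_sparse_lengths {β α : ℝ} (hβ : 1 < β) (hα : 0 ≤ α) :
    ∃ ℓ : ℕ → ℕ, (∀ k : ℕ, β ^ ℓ k ≤ ((k : ℝ) + 1) ^ α) ∧
      (∃ᶠ k : ℕ in atTop, ((k : ℝ) + 1) ^ α ≤ β * β ^ ℓ k) ∧
      ∀ δ > 0, ∃ C : ℝ, ∀ k : ℕ, ((∑ i ∈ Finset.range k, ℓ i : ℕ) : ℝ) ≤ δ * k + C := by
  classical
  have hβ0 : 0 < β := by linarith
  have hlogβ : 0 < Real.log β := Real.log_pos hβ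
  have hlog : ∀ k : ℕ, 0 ≤ Real.log ((k : ℝ) + 1) := fun k => Real.log_nonneg (by linarith [k.cast_nonneg (α := ℝ)])
  set g : ℕ → ℝ := fun k => α * Real.log ((k : ℝ) + 1) / Real.log β with hg
  have hg0 : ∀ k, 0 ≤ g k := fun k => div_nonneg (mul_nonneg hα (hlog k)) hlogβ.le
  have hpow : ∀ k : ℕ, β ^ (g k) = ((k : ℝ) + 1) ^ α := by
    intro k
    rw [Real.rpow_def_of_pos hβ0, Real.rpow_def_of_pos (by positivity), hg]
    congr 1
    field_simp
  set ℓ : ℕ → ℕ := fun k => if k + 1 = 2 ^ Nat.log 2 (k + 1) then ⌊g k⌋₊ else 0 with hℓ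
  have hℓg : ∀ k, (ℓ k : ℝ) ≤ g k := by
    intro k
    simp only [hℓ]
    split_ifs
    · exact Nat.floor_le (hg0 k)
    · simpa using hg0 k
  refine ⟨ℓ, fun k => ?_, ?_, ?_⟩
  · rw [← hpow, ← Real.rpow_natCast]
    exact Real.rpow_le_rpow_of_exponent_le hβ.le (hℓg k)
  · rw [frequently_atTop]
    intro n
    refine ⟨2 ^ n - 1, Nat.le_sub_one_of_lt Nat.lt_two_pow_self, ?_⟩
    have h1 : 2 ^ n - 1 + 1 = 2 ^ n := Nat.sub_add_cancel Nat.one_le_two_pow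
    have h2 : ℓ (2 ^ n - 1) = ⌊g (2 ^ n - 1)⌋₊ := by
      simp only [hℓ]
      rw [if_pos]
      rw [h1, Nat.log_pow (by norm_num)]
    rw [← hpow, ← pow_succ', ← Real.rpow_natCast, h2]
    refine Real.rpow_le_rpow_of_exponent_le hβ.le ?_
    push_cast
    exact (Nat.lt_floor_add_one _).le
  · intro δ hδ
    -- At most `log₂ k + 1` indices carry zeros, each at most `α log k / log β` of them.
    have hbound : ∀ k : ℕ, 1 ≤ k → ((∑ i ∈ Finset.range k, ℓ i : ℕ) : ℝ) ≤
        (Real.log k / Real.log 2 + 1) * (α * Real.log k / Real.log β) := by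
      intro k hk
      set P := (Finset.range k).filter fun i => i + 1 = 2 ^ Nat.log 2 (i + 1) with hP
      have hcard : P.card ≤ Nat.log 2 k + 1 := by
        rw [← Finset.card_range (Nat.log 2 k + 1)]
        refine Finset.card_le_card_of_injOn (fun i => Nat.log 2 (i + 1)) ?_ ?_
        · intro i hi
          have : i < k := by simpa using (Finset.mem_filter.mp hi).1
          have := Nat.log_mono_right (b := 2) (show i + 1 ≤ k by omega)
          simp; omega
        · intro i hi j hj hij
          have h1 := (Finset.mem_filter.mp hi).2
          have h2 := (Finset.mem_filter.mp hj).2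
          simp only at hij
          rw [hij, ← h2] at h1
          omega
      have hk1 : (1 : ℝ) ≤ k := by exact_mod_cast hk
      have hlk : 0 ≤ Real.log k := Real.log_nonneg hk1
      have hnl : (Nat.log 2 k : ℝ) ≤ Real.log k / Real.log 2 := by
        rw [le_div_iff₀ (Real.log_pos (by norm_num)), ← Real.log_pow]
        refine Real.log_le_log (by positivity) ?_
        exact_mod_cast Nat.pow_log_le_self 2 (by omega)
      calc ((∑ i ∈ Finset.range k, ℓ i : ℕ) : ℝ) = ∑ i ∈ Finset.range k, (ℓ i : ℝ) := by push_cast; rfl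
        _ = ∑ i ∈ P, (ℓ i : ℝ) := by
            rw [hP, Finset.sum_filter]
            refine Finset.sum_congr rfl fun i _ => ?_
            split_ifs with h
            · rfl
            · simp [hℓ, h]
        _ ≤ ∑ i ∈ P, α * Real.log k / Real.log β := by
            refine Finset.sum_le_sum fun i hi => (hℓg i).trans ?_
            have : i < k := by simpa using (Finset.mem_filter.mp hi).1
            have h1 : (i : ℝ) + 1 ≤ k := by exact_mod_cast this
            simp only [hg]
            gcongr
        _ = P.card * (α * Real.log k / Real.log β) := by simp
        _ ≤ _ := by
            gcongr
            calc (P.card : ℝ) ≤ Nat.log 2 k + 1 := by exact_mod_cast hcard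
              _ ≤ _ := by linarith
    have hlit : (fun x : ℝ => (Real.log x / Real.log 2 + 1) * (α * Real.log x / Real.log β)) =o[atTop]
        (id : ℝ → ℝ) := by
      have h2 := (Real.isLittleO_pow_log_id_atTop (n := 2)).const_mul_left
        (α / (Real.log 2 * Real.log β))
      have h1 := (Real.isLittleO_pow_log_id_atTop (n := 1)).const_mul_left (α / Real.log β)
      refine (h2.add h1).congr_left fun x => ?_
      have : 0 < Real.log 2 := Real.log_pos (by norm_num)
      field_simp
    have hev := (hlit.comp_tendsto tendsto_natCast_atTop_atTop).bound hδ
    obtain ⟨k₀, hk₀⟩ := eventually_atTop.mp hev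
    refine ⟨((∑ i ∈ Finset.range (max k₀ 1), ℓ i : ℕ) : ℝ), fun k => ?_⟩
    rcases le_total (max k₀ 1) k with h | h
    · have h1 := hbound k (le_trans (le_max_right _ _) h)
      have h2 := hk₀ k (le_trans (le_max_left _ _) h)
      simp only [Function.comp, Real.norm_eq_abs, id, Nat.abs_cast] at h2
      have h3 := le_abs_self ((Real.log k / Real.log 2 + 1) * (α * Real.log k / Real.log β))
      have h4 : (0 : ℝ) ≤ ((∑ i ∈ Finset.range (max k₀ 1), ℓ i : ℕ) : ℝ) := Nat.cast_nonneg _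
      linarith
    · have h1 : ((∑ i ∈ Finset.range k, ℓ i : ℕ) : ℝ) ≤
          ((∑ i ∈ Finset.range (max k₀ 1), ℓ i : ℕ) : ℝ) := by
        exact_mod_cast Finset.sum_le_sum_of_subset (Finset.range_mono h)
      have : 0 ≤ δ * k := by positivity
      linarith

/-! ### Computation of the exponent -/

theorem orbitExponent_eq {β x α : ℝ} (c C : ℝ) (hc : 0 < c)
    (hlow : ∀ᶠ n : ℕ in atTop, c * (n : ℝ) ^ (-α) ≤ (betaT β)^[n] x)
    (hup : ∃ᶠ n : ℕ in atTop, (betaT β)^[n] x ≤ C * (n : ℝ) ^ (-α)) :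
    orbitExponent β x = ((-α : ℝ) : EReal) := by
  set y : ℕ → ℝ := fun n => (betaT β)^[n] x with hy
  have hlogn : Tendsto (fun n : ℕ => Real.log (n : ℝ)) atTop atTop :=
    Real.tendsto_log_atTop.comp tendsto_natCast_atTop_atTop
  have hlim : ∀ D : ℝ, Tendsto (fun n : ℕ => Real.log D / Real.log (n : ℝ)) atTop (nhds 0) :=
    fun D => hlogn.const_div_atTop _
  have hpos : ∀ᶠ n : ℕ in atTop, 2 ≤ n ∧ 0 < y n ∧
      ENNReal.log (ENNReal.ofReal (y n)) / ((Real.log (n : ℝ) : ℝ) : EReal) =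
        ((Real.log (y n) / Real.log n : ℝ) : EReal) := by
    filter_upwards [hlow, eventually_ge_atTop 2] with n h1 h2
    have hn : (0 : ℝ) < n := by exact_mod_cast (by omega : 0 < n)
    have : 0 < y n := lt_of_lt_of_le (by positivity) h1
    refine ⟨h2, this, ?_⟩
    rw [ENNReal.log_ofReal_of_pos this, ← EReal.coe_div]
  have hlogmul : ∀ (n : ℕ) (D : ℝ), 2 ≤ n → 0 < D →
      Real.log (D * (n : ℝ) ^ (-α)) / Real.log n = -α + Real.log D / Real.log n := by
    intro n D hn hD
    have hn1 : (1 : ℝ) < n := by exact_mod_cast hn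
    have : 0 < Real.log n := Real.log_pos hn1
    rw [Real.log_mul hD.ne' (by positivity), Real.log_rpow (by linarith)]
    field_simp
    ring
  unfold orbitExponent
  refine le_antisymm ?_ ?_
  · refine EReal.le_of_forall_lt_iff_le.mp fun z hz => ?_
    have hz' : -α < z := by exact_mod_cast hz
    refine liminf_le_of_frequently_le' ?_
    refine (hup.and_eventually (hpos.and
      ((hlim C).eventually (gt_mem_nhds (show 0 < z + α by linarith))))).mono ?_
    rintro n ⟨h1, ⟨h2, h3, h4⟩, h5⟩
    have hn1 : (1 : ℝ) < n := by exact_mod_cast h2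
    have hn : (0 : ℝ) < (n : ℝ) ^ (-α) := by positivity
    have hC : 0 < C := pos_of_mul_pos_left (lt_of_lt_of_le h3 h1) hn.le
    rw [h4]
    have h6 : Real.log (y n) / Real.log n ≤ -α + Real.log C / Real.log n := by
      rw [← hlogmul n C h2 hC]
      have := Real.log_pos hn1
      gcongr
    exact_mod_cast (by linarith : Real.log (y n) / Real.log n ≤ z)
  · refine EReal.ge_of_forall_gt_iff_ge.mp fun z hz => ?_
    have hz' : z < -α := by exact_mod_cast hz
    refine le_liminf_of_le (by isBoundedDefault) ?_
    filter_upwards [hlow, hpos, (hlim c).eventually (lt_mem_nhds (show z + α < 0 by linarith))]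
      with n h1 ⟨h2, h3, h4⟩ h5
    have hn1 : (1 : ℝ) < n := by exact_mod_cast h2
    rw [h4]
    have h6 : -α + Real.log c / Real.log n ≤ Real.log (y n) / Real.log n := by
      rw [← hlogmul n c h2 hc]
      have := Real.log_pos hn1
      gcongr
    exact_mod_cast (by linarith : z ≤ Real.log (y n) / Real.log n)

theorem orbitExponent_blockTail {β α : ℝ} (hβ : 1 < β) (hα : 0 ≤ α) {N : ℕ} (hN : 1 ≤ N) {c : ℝ}
    (hc : 0 < c) {ℓ : ℕ → ℕ} {a : ℕ → ℝ} (ha : ∀ k, a k ∈ blockAlphabet β N c)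
    (hℓ : ∀ k : ℕ, β ^ ℓ k ≤ ((k : ℝ) + 1) ^ α)
    (hℓ' : ∃ᶠ k : ℕ in atTop, ((k : ℝ) + 1) ^ α ≤ β * β ^ ℓ k) {C : ℝ}
    (hC : ∀ k : ℕ, ((∑ i ∈ Finset.range k, ℓ i : ℕ) : ℝ) ≤ k + C) :
    orbitExponent β (blockTail β N ℓ a 0) = ((-α : ℝ) : EReal) := by
  have hβ0 : 0 < β := by linarith
  have hC0 : 0 ≤ C := by simpa using hC 0
  refine orbitExponent_eq (c / (β ^ N * 2 ^ α)) (β * (N + 1 + C) ^ α) (by positivity) ?_ ?_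
  · filter_upwards [eventually_ge_atTop 1] with t ht
    obtain ⟨k, hk, h⟩ := exists_le_iterate_blockTail (ℓ := ℓ) hβ hN hc ha t
    refine le_trans ?_ h
    have ht1 : (1 : ℝ) ≤ t := by exact_mod_cast ht
    have hkt : (k : ℝ) ≤ t := by exact_mod_cast hk
    have h1 : β ^ ℓ k ≤ 2 ^ α * (t : ℝ) ^ α := by
      rw [← Real.mul_rpow (by norm_num) (by linarith)]
      refine (hℓ k).trans (Real.rpow_le_rpow (by positivity) (by linarith) hα)
    rw [Real.rpow_neg (by linarith), ← div_eq_mul_inv, div_div, mul_assoc]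
    gcongr
  · have htend : Tendsto (fun k => blockTime N ℓ k + N) atTop atTop :=
      tendsto_atTop_mono (fun k => (le_blockTime hN ℓ k).trans (Nat.le_add_right _ _)) tendsto_id
    refine htend.frequently (hℓ'.mono fun k hk => ?_)
    refine (iterate_blockTime_add hβ hc ha k).trans ?_
    -- Time is at most linear in the block index, so powers of `k + 1` can be traded for powers of
    -- the time.
    have hn : ((blockTime N ℓ k + N : ℕ) : ℝ) ≤ (N + 1 + C) * (k + 1) := by
      have := hC k
      have : 0 ≤ C * k := by positivity
      rw [blockTime_eq]
      push_cast at *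
      nlinarith
    have hn0 : (0 : ℝ) < ((blockTime N ℓ k + N : ℕ) : ℝ) := by
      exact_mod_cast (by omega : 0 < blockTime N ℓ k + N)
    have h1 : ((blockTime N ℓ k + N : ℕ) : ℝ) ^ α ≤ (N + 1 + C) ^ α * (β * β ^ ℓ k) := by
      calc _ ≤ ((N + 1 + C) * (k + 1 : ℝ)) ^ α := Real.rpow_le_rpow hn0.le hn hα
        _ = (N + 1 + C) ^ α * ((k : ℝ) + 1) ^ α := Real.mul_rpow (by positivity) (by positivity)
        _ ≤ _ := by gcongr
    rw [Real.rpow_neg hn0.le, ← div_eq_mul_inv, div_le_div_iff₀ (by positivity) (by positivity)]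
    linarith

/-! ### Conclusion -/

theorem dimH_orbitExponent_eq {β α : ℝ} (hβ : 1 < β) (hα : 0 ≤ α) :
    dimH {x : ℝ | x ∈ Ico (0 : ℝ) 1 ∧ orbitExponent β x = ((-α : ℝ) : EReal)} = 1 := by
  have hβ0 : 0 < β := by linarith
  refine le_antisymm ((dimH_mono (subset_univ _)).trans Real.dimH_univ.le)
    (ENNReal.le_of_forall_nnreal_lt fun r hr => ?_)
  rcases eq_or_ne r 0 with rfl | hr0
  · simp
  have hr0 : 0 < r := pos_iff_ne_zero.mpr hr0
  have hr0R : (0 : ℝ) < r := by exact_mod_cast hr0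
  have hr1 : (r : ℝ) < 1 := by exact_mod_cast hr
  -- Blocks are chosen for the exponent `(r + 1) / 2`; the gap `(1 - r) / 2` up to it absorbs the
  -- zeros.
  obtain ⟨N, hN, M, hM, hNM, c, hc, e, he, heA⟩ :=
    exists_blocks hβ (r := ((r : ℝ) + 1) / 2) (by linarith) (by linarith)
  obtain ⟨ℓ, hℓ, hℓ', hsum⟩ := exists_sparse_lengths hβ hα
  obtain ⟨C₁, hC₁⟩ := hsum 1 one_pos
  obtain ⟨C, hC⟩ := hsum ((1 - (r : ℝ)) / 2) (by linarith)
  refine (le_dimH_range_blockTail (ℓ := ℓ) (C := β ^ C) hβ hc hM he heA hr0 fun k => ?_).trans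
    (dimH_mono ?_)
  · have hNR : (1 : ℝ) ≤ N := by exact_mod_cast hN
    have hk0 : (0 : ℝ) ≤ k := Nat.cast_nonneg k
    have hL0 : (0 : ℝ) ≤ ((∑ i ∈ Finset.range k, ℓ i : ℕ) : ℝ) := Nat.cast_nonneg _
    have hL := hC k
    set L := ∑ i ∈ Finset.range k, ℓ i with hLdef
    have h1 : ((blockTime N ℓ k : ℕ) : ℝ) * r ≤ C + N * (((r : ℝ) + 1) / 2) * k := by
      rw [blockTime_eq]
      push_cast [← hLdef]
      have h2 : (L : ℝ) * r ≤ L := mul_le_of_le_one_right hL0 hr1.le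
      have h3 : (1 - (r : ℝ)) / 2 * k ≤ (1 - (r : ℝ)) / 2 * k * N :=
        le_mul_of_one_le_right (mul_nonneg (by linarith) hk0) hNR
      nlinarith
    calc (β ^ blockTime N ℓ k) ^ (r : ℝ) = β ^ ((blockTime N ℓ k : ℕ) * (r : ℝ)) := by
          rw [Real.rpow_natCast_mul hβ0.le]
      _ ≤ β ^ (C + N * (((r : ℝ) + 1) / 2) * k) := Real.rpow_le_rpow_of_exponent_le hβ.le h1
      _ = β ^ C * ((β ^ N) ^ (((r : ℝ) + 1) / 2)) ^ k := by
          rw [Real.rpow_add hβ0, Real.rpow_mul_natCast hβ0.le, Real.rpow_natCast_mul hβ0.le]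
      _ ≤ β ^ C * (M : ℝ) ^ k := by gcongr
  · rintro _ ⟨d, rfl⟩
    have ha : ∀ k, e (d k) ∈ blockAlphabet β N c := fun k => heA _
    exact ⟨blockTail_mem_Ico hβ hc ha 0,
      orbitExponent_blockTail hβ hα hN hc ha hℓ hℓ' (by simpa using hC₁)⟩

theorem mainTheorem10 (β : ℝ) (hβ : 1 < β) :
    (∀ α : ℝ, 0 ≤ α →
      dimH {x : ℝ | x ∈ Ico (0 : ℝ) 1 ∧ orbitExponent β x = ((-α : ℝ) : EReal)} = 1) ∧
    dimH {x : ℝ | x ∈ Ico (0 : ℝ) 1 ∧ orbitExponent β x ≠ ((-1 : ℝ) : EReal)} = 1 := by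
  refine ⟨fun α hα => dimH_orbitExponent_eq hβ hα,
    le_antisymm ((dimH_mono (subset_univ _)).trans Real.dimH_univ.le) ?_⟩
  -- The level set for `α = 0` already suffices.
  rw [← dimH_orbitExponent_eq hβ le_rfl]
  refine dimH_mono fun x hx => ⟨hx.1, ?_⟩
  rw [hx.2, Ne, EReal.coe_eq_coe_iff]
  norm_num
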